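/- Let $n$ be a non-negative integer. There is a constant $C(n)>0$, depending only on $n$, such that the following holds for every finite chain ring $R$, that is, every finite commutative unital local ring all of whose ideals are principal. Let $\mathfrak m=(\pi)$ be the maximal ideal of $R$, let $q=|R/\mathfrak m|$ be the order of the residue field, and let $r$ be the smallest positive integer with $\pi^r=0$. Let $A,B,C,D,E,F$ be arbitrary subsets of the ring $\mathrm{M}_n(R)$ of $n\times n$ matrices over $R$, and let $N(A,B,C,D,E,F)$ be the number of tuples $(a,b,c,d,e,f)\in A\times B\times C\times D\times E\times F$ with $ab+ef=c+d$. Then $$\left|N(A,B,C,D,E,F)-\frac{|A||B||C||D||E||F|}{q^{rn^2}}\right|\le C(n)\,q^{2rn^2-\frac{n+1}{2}}\sqrt{|A||B||C||D||E||F|}.$$ -/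

import Mathlib

/-- The number of solutions of `a b + e f = c + d` with
`(a, b, c, d, e, f) ∈ A × B × C × D × E × F`, for sets of `n × n` matrices over `R`. -/
noncomputable def matrixSolutionCount {R : Type*} [CommRing R] {n : ℕ}
    (A B C D E F : Set (Matrix (Fin n) (Fin n) R)) : ℕ :=
  Set.ncard {x : Matrix (Fin n) (Fin n) R × Matrix (Fin n) (Fin n) R ×
      Matrix (Fin n) (Fin n) R × Matrix (Fin n) (Fin n) R ×
      Matrix (Fin n) (Fin n) R × Matrix (Fin n) (Fin n) R |
    match x with
    | (a, b, c, d, e, f) =>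
      a ∈ A ∧ b ∈ B ∧ c ∈ C ∧ d ∈ D ∧ e ∈ E ∧ f ∈ F ∧ a * b + e * f = c + d}

/-!
The count is evaluated by Fourier analysis on the finite additive group `G` of the matrix ring
`Mₙ(R)`. Summing `χ (a b + e f - c - d)` over all additive characters `χ` of `G` gives
`|G| N = ∑ χ, S χ A B * S χ E F * conj (S χ C) * conj (S χ D)`, where
`S χ A B = ∑ a ∈ A, ∑ b ∈ B, χ (a b)` and `S χ C = ∑ c ∈ C, χ c` (`card_mul_count_eq_sum_char`).
The trivial character contributes `|A||B||C||D||E||F|`, and everything else is error.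

* Cauchy–Schwarz and orthogonality bound a bilinear sum by
  `|S χ A B|² ≤ |A||B||G| |Ann χ|`, where `Ann χ = {a | ∀ b, χ (a b) = 1}`
  (`norm_bilinear_sum_sq_le`).
* Parseval's identity `∑ χ, |S χ C|² = |G||C|` (`sum_norm_sq_charSum`) and Cauchy–Schwarz control
  the sum over `χ` of the product of the two linear factors.

So if `|Ann χ| ≤ β` for all `χ ≠ 0`, the error in `N` is at most
`|G| β √(|A||B||C||D||E||F|)`; this is `abs_count_sub_le`, valid in any finite ring.

For `χ ≠ 0` the group `Ann χ` is a proper right ideal of `Mₙ(R)`. A proper right ideal misses some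
matrix unit `Eᵢᵢ`; the vectors `v` for which the matrix with `i`-th row `v` and zeros elsewhere lies
in the ideal can then have no unit coordinate, so distinct vectors over the residue field give
distinct cosets and the index is at least `qⁿ` (`card_mul_pow_le_of_right_ideal`). With
`|R| = q ^ r` (`card_eq_card_residueField_pow`), the error exponent is `2 r n² - n`, which is at
most `2 r n² - (n + 1) / 2` when `n ≥ 1`; for `n = 0` there is no nontrivial character and the
error vanishes. The constant can thus be taken to be `1`.
-/

/-! ### Character sums in a finite ring -/

section CharSums

open scoped Finset

/-- Parseval's identity for the indicator function of `C`. -/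
theorem sum_norm_sq_charSum {G : Type*} [AddCommGroup G] [Fintype G] (C : Finset G) :
    ∑ χ : AddChar G ℂ, ‖∑ c ∈ C, χ c‖ ^ 2 = Fintype.card G * #C := by
  classical
  have key : ∑ χ : AddChar G ℂ, ((‖∑ c ∈ C, χ c‖ : ℂ)) ^ 2 = Fintype.card G * #C := by
    calc ∑ χ : AddChar G ℂ, ((‖∑ c ∈ C, χ c‖ : ℂ)) ^ 2
        = ∑ χ : AddChar G ℂ, ∑ c ∈ C, ∑ c' ∈ C, χ (c - c') := by
          refine Finset.sum_congr rfl fun χ _ => ?_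
          rw [← Complex.mul_conj', map_sum, Finset.sum_mul_sum]
          simp_rw [← AddChar.map_neg_eq_conj, ← AddChar.map_add_eq_mul, sub_eq_add_neg]
      _ = ∑ c ∈ C, ∑ c' ∈ C, ∑ χ : AddChar G ℂ, χ (c - c') := by
          rw [Finset.sum_comm]
          exact Finset.sum_congr rfl fun c _ => Finset.sum_comm
      _ = Fintype.card G * #C := by
          simp_rw [AddChar.sum_apply_eq_ite, sub_eq_zero]
          simp [mul_comm]
  exact_mod_cast key

/-- The elements `a` for which the twisted character `b ↦ χ (a * b)` is trivial. They form the
largest right ideal contained in the kernel of `χ`, recorded here as an additive subgroup. -/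
def AddChar.annihilator {G M : Type*} [Ring G] [CommMonoid M] (χ : AddChar G M) :
    AddSubgroup G where
  carrier := {a | ∀ b, χ (a * b) = 1}
  zero_mem' b := by simp
  add_mem' {a a'} ha ha' b := by rw [add_mul, AddChar.map_add_eq_mul, ha b, ha' b, one_mul]
  neg_mem' {a} ha b := by rw [neg_mul, ← mul_neg]; exact ha _

theorem AddChar.mem_annihilator {G M : Type*} [Ring G] [CommMonoid M] {χ : AddChar G M} {a : G} :
    a ∈ χ.annihilator ↔ ∀ b, χ (a * b) = 1 := Iff.rfl

open scoped Classical in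
theorem sum_char_mul {G : Type*} [Ring G] [Fintype G] (χ : AddChar G ℂ) (a : G) :
    ∑ b, χ (a * b) = if a ∈ χ.annihilator then (Fintype.card G : ℂ) else 0 := by
  have h := AddChar.sum_eq_ite (χ.compAddMonoidHom (AddMonoidHom.mulLeft a))
  simp only [AddChar.compAddMonoidHom_apply, AddMonoidHom.coe_mulLeft] at h
  rw [h]
  refine if_congr ?_ rfl rfl
  rw [AddChar.mem_annihilator, AddChar.eq_zero_iff]
  rfl

/-- The bilinear character sum over `A × B` is controlled by the annihilator of `χ`: the matrix
`(χ (a * b))` times its conjugate transpose has entries `|G|` where `a - a'` annihilates `χ` and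
`0` elsewhere. -/
theorem norm_bilinear_sum_sq_le {G : Type*} [Ring G] [Fintype G] (χ : AddChar G ℂ)
    (A B : Finset G) :
    ‖∑ a ∈ A, ∑ b ∈ B, χ (a * b)‖ ^ 2 ≤
      #A * #B * Fintype.card G * Nat.card χ.annihilator := by
  classical
  have key : ∑ b, ‖∑ a ∈ A, χ (a * b)‖ ^ 2 =
      Fintype.card G * ∑ a ∈ A, (#{a' ∈ A | a - a' ∈ χ.annihilator} : ℝ) := by
    have : ∑ b, ((‖∑ a ∈ A, χ (a * b)‖ : ℂ)) ^ 2 =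
      Fintype.card G * ∑ a ∈ A, (#{a' ∈ A | a - a' ∈ χ.annihilator} : ℂ) := by
      calc ∑ b, ((‖∑ a ∈ A, χ (a * b)‖ : ℂ)) ^ 2
          = ∑ b, ∑ a ∈ A, ∑ a' ∈ A, χ ((a - a') * b) := by
            refine Finset.sum_congr rfl fun b _ => ?_
            rw [← Complex.mul_conj', map_sum, Finset.sum_mul_sum]
            simp_rw [← AddChar.map_neg_eq_conj, ← AddChar.map_add_eq_mul, ← sub_eq_add_neg,
              ← sub_mul]
        _ = ∑ a ∈ A, ∑ a' ∈ A, ∑ b, χ ((a - a') * b) := by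
            rw [Finset.sum_comm]
            exact Finset.sum_congr rfl fun c _ => Finset.sum_comm
        _ = _ := by
            simp_rw [sum_char_mul, Finset.mul_sum, Finset.card_filter, Nat.cast_sum,
              Finset.mul_sum]
            simp
    exact_mod_cast this
  -- For fixed `a`, the map `a' ↦ a - a'` is injective.
  have hfib (a : G) : #{a' ∈ A | a - a' ∈ χ.annihilator} ≤ Nat.card χ.annihilator := by
    rw [Nat.card_eq_fintype_card, ← Finset.card_univ]
    refine Finset.card_le_card_of_injOn
      (fun a' => if h : a - a' ∈ χ.annihilator then ⟨a - a', h⟩ else 0) (by simp) ?_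
    intro x hx y hy hxy
    simp only [Finset.coe_filter, Set.mem_ofPred_eq] at hx hy
    simpa [hx.2, hy.2] using hxy
  calc ‖∑ a ∈ A, ∑ b ∈ B, χ (a * b)‖ ^ 2
      ≤ (∑ b ∈ B, ‖∑ a ∈ A, χ (a * b)‖) ^ 2 := by
        rw [Finset.sum_comm]
        gcongr
        exact norm_sum_le _ _
    _ ≤ #B * ∑ b ∈ B, ‖∑ a ∈ A, χ (a * b)‖ ^ 2 := sq_sum_le_card_mul_sum_sq
    _ ≤ #B * ∑ b, ‖∑ a ∈ A, χ (a * b)‖ ^ 2 := by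
        gcongr
        exact Finset.subset_univ B
    _ ≤ #B * (Fintype.card G * ∑ a ∈ A, (Nat.card χ.annihilator : ℝ)) := by
        rw [key]
        gcongr with a _
        exact hfib a
    _ = _ := by rw [Finset.sum_const, nsmul_eq_mul]; ring

theorem card_mul_count_eq_sum_char {G : Type*} [Ring G] [Fintype G] [DecidableEq G]
    (A B C D E F : Finset G) :
    (Fintype.card G : ℂ) * #{x ∈ A ×ˢ B ×ˢ C ×ˢ D ×ˢ E ×ˢ F |
        x.1 * x.2.1 + x.2.2.2.2.1 * x.2.2.2.2.2 = x.2.2.1 + x.2.2.2.1} =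
      ∑ χ : AddChar G ℂ, (∑ a ∈ A, ∑ b ∈ B, χ (a * b)) * (∑ e ∈ E, ∑ f ∈ F, χ (e * f)) *
        ((∑ c ∈ C, χ (-c)) * ∑ d ∈ D, χ (-d)) := by
  have h (χ : AddChar G ℂ) :
      (∑ a ∈ A, ∑ b ∈ B, χ (a * b)) * (∑ e ∈ E, ∑ f ∈ F, χ (e * f)) *
        ((∑ c ∈ C, χ (-c)) * ∑ d ∈ D, χ (-d)) =
      ∑ x ∈ A ×ˢ B ×ˢ C ×ˢ D ×ˢ E ×ˢ F,
        χ (x.1 * x.2.1 + x.2.2.2.2.1 * x.2.2.2.2.2 - (x.2.2.1 + x.2.2.2.1)) := by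
    simp only [Finset.sum_product]
    simp only [sub_eq_add_neg, neg_add, AddChar.map_add_eq_mul, ← Finset.mul_sum,
      ← Finset.sum_mul]
  simp_rw [h]
  rw [Finset.sum_comm]
  simp_rw [AddChar.sum_apply_eq_ite, sub_eq_zero, ← Finset.sum_filter]
  rw [Finset.sum_const, nsmul_eq_mul, mul_comm]

/-- A uniform bound `β` on the annihilators of the nontrivial characters of a finite ring makes the
number of solutions of `a b + e f = c + d` close to its expected value. -/
theorem abs_count_sub_le {G : Type*} [Ring G] [Fintype G] [DecidableEq G] {β : ℝ} (hβ : 0 ≤ β)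
    (h : ∀ χ : AddChar G ℂ, χ ≠ 0 → (Nat.card χ.annihilator : ℝ) ≤ β)
    (A B C D E F : Finset G) :
    |((#{x ∈ A ×ˢ B ×ˢ C ×ˢ D ×ˢ E ×ˢ F |
        x.1 * x.2.1 + x.2.2.2.2.1 * x.2.2.2.2.2 = x.2.2.1 + x.2.2.2.1} : ℕ) : ℝ) -
      (#A * #B * #C * #D * #E * #F : ℝ) / (Fintype.card G : ℝ)| ≤
      Fintype.card G * β * √(#A * #B * #C * #D * #E * #F) := by
  set g : ℝ := (Fintype.card G : ℝ) with hg
  have hg0 : 0 < g := by simp [hg, Fintype.card_pos]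
  have key := card_mul_count_eq_sum_char A B C D E F
  set N := #{x ∈ A ×ˢ B ×ˢ C ×ˢ D ×ˢ E ×ˢ F |
        x.1 * x.2.1 + x.2.2.2.2.1 * x.2.2.2.2.2 = x.2.2.1 + x.2.2.2.1}
  -- Split off the trivial character, which gives the main term.
  rw [← Finset.add_sum_erase _ _ (Finset.mem_univ (0 : AddChar G ℂ))] at key
  have hbil (χ : AddChar G ℂ) (hχ : χ ≠ 0) (X Y : Finset G) :
      ‖∑ a ∈ X, ∑ b ∈ Y, χ (a * b)‖ ≤ √(#X * #Y * g * β) := by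
    apply Real.le_sqrt_of_sq_le
    refine (norm_bilinear_sum_sq_le χ X Y).trans ?_
    have := h χ hχ
    gcongr
  have hneg (χ : AddChar G ℂ) (X : Finset G) : ‖∑ c ∈ X, χ (-c)‖ = ‖∑ c ∈ X, χ c‖ := by
    simp_rw [AddChar.map_neg_eq_conj, ← map_sum]
    exact RCLike.norm_conj _
  have hCD : ∑ χ : AddChar G ℂ, ‖∑ c ∈ C, χ c‖ * ‖∑ d ∈ D, χ d‖ ≤ g * √(#C * #D) := by
    refine (Real.sum_mul_le_sqrt_mul_sqrt _ _ _).trans_eq ?_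
    rw [sum_norm_sq_charSum, sum_norm_sq_charSum, ← Real.sqrt_mul (by positivity),
      show (g * #C) * (g * #D) = g ^ 2 * (#C * #D : ℝ) by ring, Real.sqrt_mul (by positivity),
      Real.sqrt_sq hg0.le]
  have herr : ‖((g : ℂ) * N - #A * #B * #C * #D * #E * #F : ℂ)‖ ≤
      g * (g * β * √(#A * #B * #C * #D * #E * #F)) := by
    calc ‖((g : ℂ) * N - #A * #B * #C * #D * #E * #F : ℂ)‖
        = ‖∑ χ ∈ Finset.univ.erase (0 : AddChar G ℂ),
            (∑ a ∈ A, ∑ b ∈ B, χ (a * b)) * (∑ e ∈ E, ∑ f ∈ F, χ (e * f)) *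
            ((∑ c ∈ C, χ (-c)) * ∑ d ∈ D, χ (-d))‖ := by
          congr 1
          rw [hg, Complex.ofReal_natCast, key]
          simp only [AddChar.zero_apply, Finset.sum_const, nsmul_eq_mul, mul_one]
          ring
      _ ≤ ∑ χ ∈ Finset.univ.erase (0 : AddChar G ℂ),
            √(#A * #B * g * β) * √(#E * #F * g * β) *
              (‖∑ c ∈ C, χ c‖ * ‖∑ d ∈ D, χ d‖) := by
          refine norm_sum_le_of_le _ fun χ hχ => ?_
          have hχ := Finset.ne_of_mem_erase hχ
          rw [norm_mul, norm_mul, norm_mul, hneg, hneg]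
          gcongr
          · exact hbil χ hχ A B
          · exact hbil χ hχ E F
      _ ≤ √(#A * #B * g * β) * √(#E * #F * g * β) * (g * √(#C * #D)) := by
          rw [← Finset.mul_sum]
          gcongr
          refine le_trans ?_ hCD
          exact Finset.sum_le_sum_of_subset_of_nonneg (Finset.subset_univ _)
            fun _ _ _ => by positivity
      _ = _ := by
          rw [← Real.sqrt_mul (by positivity), mul_left_comm, ← Real.sqrt_mul (by positivity),
            show (#A * #B * g * β * (#E * #F * g * β) * (#C * #D) : ℝ) =
              (g * β) ^ 2 * (#A * #B * #C * #D * #E * #F) by ring,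
            Real.sqrt_mul (by positivity), Real.sqrt_sq (by positivity)]
  have hcast : ‖((g : ℂ) * N - #A * #B * #C * #D * #E * #F : ℂ)‖ =
      |g * N - #A * #B * #C * #D * #E * #F| := by
    rw [← Real.norm_eq_abs, ← Complex.norm_real]
    push_cast
    rfl
  rw [hcast] at herr
  have : g * N - #A * #B * #C * #D * #E * #F =
      g * (N - (#A * #B * #C * #D * #E * #F : ℝ) / g) := by
    field_simp
  rw [this, abs_mul, abs_of_pos hg0] at herr
  exact le_of_mul_le_mul_left herr hg0

end CharSums

/-! ### Finite chain rings and right ideals of their matrix rings -/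

open IsLocalRing in
/-- A finite local ring with principal maximal ideal `(π)` has `q ^ r` elements: multiplication by
`π ^ k` identifies each layer `(π ^ k) / (π ^ (k + 1))` with `k < r` with the residue field. -/
theorem card_eq_card_residueField_pow {R : Type*} [CommRing R] [Finite R] [IsLocalRing R] {π : R}
    (hπ : maximalIdeal R = Ideal.span {π}) :
    Nat.card R = Nat.card (ResidueField R) ^ nilpotencyClass π := by
  have hnil : IsNilpotent π := by
    have : π ∈ maximalIdeal R := hπ ▸ Ideal.mem_span_singleton_self π
    rw [← Ring.KrullDimLE.nilradical_eq_maximalIdeal] at this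
    exact mem_nilradical.1 this
  have hmap (k : ℕ) : (Ideal.span {π ^ k}).toAddSubgroup =
      AddSubgroup.map (AddMonoidHom.mulLeft (π ^ k)) ⊤ := by
    ext x
    simp [Ideal.mem_span_singleton, dvd_def, eq_comm]
  have hmap' (k : ℕ) : (Ideal.span {π ^ (k + 1)}).toAddSubgroup =
      AddSubgroup.map (AddMonoidHom.mulLeft (π ^ k)) (maximalIdeal R).toAddSubgroup := by
    ext x
    simp only [hπ, Submodule.mem_toAddSubgroup, Ideal.mem_span_singleton, AddSubgroup.mem_map,
      AddMonoidHom.coe_mulLeft, pow_succ]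
    constructor
    · rintro ⟨y, rfl⟩
      exact ⟨π * y, dvd_mul_right _ _, by ring⟩
    · rintro ⟨_, ⟨y, rfl⟩, rfl⟩
      exact ⟨y, by ring⟩
  have hstep (k : ℕ) (hk : k < nilpotencyClass π) :
      (Ideal.span {π ^ (k + 1)}).toAddSubgroup.relIndex (Ideal.span {π ^ k}).toAddSubgroup =
        Nat.card (ResidueField R) := by
    rw [hmap', hmap, AddSubgroup.relIndex_map_map, top_sup_eq, AddSubgroup.relIndex_top_right,
      sup_eq_left.2]
    · rfl
    -- The kernel of multiplication by `π ^ k ≠ 0` contains no unit.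
    · intro x hx
      have hx : π ^ k * x = 0 := hx
      rw [Submodule.mem_toAddSubgroup, mem_maximalIdeal, mem_nonunits_iff]
      intro hu
      rw [hu.mul_left_eq_zero] at hx
      exact hk.not_ge (Nat.sInf_le hx)
  have hind (k : ℕ) (hk : k ≤ nilpotencyClass π) :
      (Ideal.span {π ^ k}).toAddSubgroup.index = Nat.card (ResidueField R) ^ k := by
    induction k with
    | zero => simp [Ideal.span_singleton_one]
    | succ k ih =>
      rw [← AddSubgroup.relIndex_mul_index (K := (Ideal.span {π ^ k}).toAddSubgroup), hstep k hk,
        ih (by omega), pow_succ']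
      refine Submodule.toAddSubgroup_mono (Ideal.span_singleton_le_span_singleton.2 ?_)
      exact pow_dvd_pow _ (Nat.le_succ k)
  rw [← hind _ le_rfl, pow_nilpotencyClass hnil]
  simp

open IsLocalRing in
/-- A proper right ideal of `Mₙ(R)` over a finite local ring with residue field of order `q` has
index at least `q ^ n`. -/
theorem card_mul_pow_le_of_right_ideal {R : Type*} [CommRing R] [Finite R] [IsLocalRing R] {n : ℕ}
    (H : AddSubgroup (Matrix (Fin n) (Fin n) R)) (hH : ∀ a ∈ H, ∀ b, a * b ∈ H) (h1 : 1 ∉ H) :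
    Nat.card H * Nat.card (ResidueField R) ^ n ≤ Nat.card (Matrix (Fin n) (Fin n) R) := by
  classical
  obtain ⟨i, hi⟩ : ∃ i, Matrix.single i i (1 : R) ∉ H := by
    by_contra! hall
    apply h1
    rw [← Matrix.sum_single_one]
    exact sum_mem fun i _ => hall i
  -- The matrix with `i`-th row `v` and zeros elsewhere lies in `H` only if `v` has no unit entry:
  -- right multiplication by a multiple of a matrix unit would otherwise produce `Eᵢᵢ`.
  have hmem (v : Fin n → R) (hv : Matrix.vecMulVec (Pi.single i 1) v ∈ H) (j : Fin n) :
      residue R (v j) = 0 := by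
    rw [residue_eq_zero_iff, mem_maximalIdeal, mem_nonunits_iff]
    rintro ⟨u, hu⟩
    apply hi
    convert hH _ hv (Matrix.single j i (↑u⁻¹ : R)) using 1
    ext k l
    rw [Matrix.mul_apply, Finset.sum_eq_single j]
    · by_cases hk : k = i <;> by_cases hl : i = l <;>
        simp [Matrix.vecMulVec_apply, Matrix.single_apply, Ne.symm, Pi.single_apply, hk, hl, ← hu,
          eq_comm]
    · intro j' _ hj'
      simp [hj'.symm]
    · simp
  choose s hs using residue_surjective (R := R)
  rw [← H.card_mul_index]
  gcongr
  have : Nat.card (Fin n → ResidueField R) = Nat.card (ResidueField R) ^ n := by simp [Nat.card_pi]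
  rw [← this, AddSubgroup.index]
  refine Nat.card_le_card_of_injective
    (fun w : Fin n → ResidueField R => (Matrix.vecMulVec (Pi.single i 1) fun j => s (w j) :
      Matrix (Fin n) (Fin n) R ⧸ H)) ?_
  intro w w' hww
  rw [QuotientAddGroup.eq, ← sub_eq_neg_add, ← Matrix.vecMulVec_sub] at hww
  funext j
  have := hmem _ hww j
  simp only [Pi.sub_apply, map_sub, hs, sub_eq_zero] at this
  exact this.symm

open IsLocalRing in
theorem card_annihilator_mul_pow_le {R : Type*} [CommRing R] [Finite R] [IsLocalRing R] {n : ℕ}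
    {χ : AddChar (Matrix (Fin n) (Fin n) R) ℂ} (hχ : χ ≠ 0) :
    Nat.card χ.annihilator * Nat.card (ResidueField R) ^ n ≤
      Nat.card (Matrix (Fin n) (Fin n) R) := by
  refine card_mul_pow_le_of_right_ideal _ (fun a ha b c => ?_) fun h1 => hχ ?_
  · rw [mul_assoc]
    exact ha _
  · rw [AddChar.eq_zero_iff]
    intro x
    simpa using h1 x

/-! ### The number of solutions -/

theorem matrixSolutionCount_eq_card_filter {R : Type*} [CommRing R] [DecidableEq R] {n : ℕ}
    (A B C D E F : Finset (Matrix (Fin n) (Fin n) R)) :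
    matrixSolutionCount (A : Set (Matrix (Fin n) (Fin n) R)) B C D E F =
      (Finset.filter (fun x => x.1 * x.2.1 + x.2.2.2.2.1 * x.2.2.2.2.2 = x.2.2.1 + x.2.2.2.1)
        (A ×ˢ B ×ˢ C ×ˢ D ×ˢ E ×ˢ F)).card := by
  rw [matrixSolutionCount, ← Set.ncard_coe_finset]
  congr 1
  ext ⟨a, b, c, d, e, f⟩
  simp [and_assoc]

theorem mainTheorem3 (n : ℕ) :
    ∃ K : ℝ, 0 < K ∧
      ∀ (R : Type*) [CommRing R] [Finite R] [IsLocalRing R] [IsPrincipalIdealRing R]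
        (π : R) (_ : IsLocalRing.maximalIdeal R = Ideal.span {π})
        (q r : ℕ) (_ : q = Nat.card (IsLocalRing.ResidueField R)) (_ : r = nilpotencyClass π)
        (A B C D E F : Set (Matrix (Fin n) (Fin n) R)),
        |(matrixSolutionCount A B C D E F : ℝ) -
            ((A.ncard : ℝ) * B.ncard * C.ncard * D.ncard * E.ncard * F.ncard) /
              (q : ℝ) ^ (r * n ^ 2)| ≤
          K * (q : ℝ) ^ (2 * (r : ℝ) * (n : ℝ) ^ 2 - ((n : ℝ) + 1) / 2) *
            √((A.ncard : ℝ) * B.ncard * C.ncard * D.ncard * E.ncard * F.ncard) := by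
  refine ⟨1, one_pos, ?_⟩
  intro R _ _ _ _ π hπ q r hq hr A B C D E F
  classical
  have := Fintype.ofFinite R
  have hfin : Finite (IsLocalRing.ResidueField R) :=
    Finite.of_surjective _ IsLocalRing.residue_surjective
  have hq1 : (1 : ℝ) < q := by
    rw [hq]
    exact_mod_cast Finite.one_lt_card
  have hq0 : (0 : ℝ) < q := by linarith
  have hM : Nat.card (Matrix (Fin n) (Fin n) R) = q ^ (r * n ^ 2) := by
    have : Nat.card (Matrix (Fin n) (Fin n) R) = Nat.card R ^ (n ^ 2) := by
      simp [Matrix, sq, pow_mul]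
    rw [this, card_eq_card_residueField_pow hπ, hq, hr, ← pow_mul]
  have hMR : ((q ^ (r * n ^ 2) : ℕ) : ℝ) = (q : ℝ) ^ ((r : ℝ) * (n : ℝ) ^ 2) := by
    rw [Nat.cast_pow, ← Real.rpow_natCast]
    push_cast
    rfl
  have hann (χ : AddChar (Matrix (Fin n) (Fin n) R) ℂ) (hχ : χ ≠ 0) :
      (Nat.card χ.annihilator : ℝ) ≤ (q : ℝ) ^ ((r : ℝ) * (n : ℝ) ^ 2 - ((n : ℝ) + 1) / 2) := by
    -- The ring of `0 × 0` matrices has no nonzero character, so `1 ≤ n` and `(n + 1) / 2 ≤ n`.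
    have hn : 1 ≤ n := by
      by_contra! hn
      obtain rfl : n = 0 := by omega
      obtain ⟨x, hx⟩ := AddChar.ne_zero_iff.1 hχ
      exact hx (by rw [Subsingleton.elim x 0, AddChar.map_zero_eq_one])
    have h := card_annihilator_mul_pow_le hχ
    rw [hM, ← hq] at h
    have h : (Nat.card χ.annihilator : ℝ) * (q : ℝ) ^ (n : ℝ) ≤
        (q : ℝ) ^ ((r : ℝ) * (n : ℝ) ^ 2) := by
      rw [← hMR, Real.rpow_natCast]
      exact_mod_cast h
    rw [← le_div_iff₀ (by positivity), ← Real.rpow_sub hq0] at h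
    refine h.trans (Real.rpow_le_rpow_of_exponent_le hq1.le ?_)
    have : (1 : ℝ) ≤ n := by exact_mod_cast hn
    linarith
  have key := abs_count_sub_le (by positivity) hann A.toFinset B.toFinset C.toFinset D.toFinset
    E.toFinset F.toFinset
  rw [← matrixSolutionCount_eq_card_filter, ← Nat.card_eq_fintype_card, hM] at key
  simp only [Set.coe_toFinset, ← Set.ncard_eq_toFinset_card'] at key
  rw [Nat.cast_pow] at key
  refine key.trans_eq ?_
  rw [← Nat.cast_pow, hMR, ← Real.rpow_add hq0, one_mul]
  congr 2
  ring
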